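/- Let $B$ be a Boolean algebra with $\mathbf 0\neq\mathbf 1$. An antichain in $B$ is a set of pairwise disjoint elements. A finitely additive measure on $B$ is a function $m:B\to\mathbb R$ with $m(\mathbf 0)=0$, $m(\mathbf 1)=1$, $m(a)\le m(b)$ whenever $a\le b$, and $m(a\vee b)=m(a)+m(b)$ whenever $a\wedge b=\mathbf 0$; it is strictly positive if $m(a)=0$ only for $a=\mathbf 0$. A convergence ideal on $B$ is a set $I$ of infinite sequences in $B$ such that: (i) if $(a_n)_n\in I$, then $\bigwedge_n a_n=\mathbf 0$, i.e. no $a>\mathbf 0$ satisfies $a\le a_n$ for all $n$; (ii) every infinite subsequence of a member of $I$ is in $I$; (iii) if $(a_n)_n\in I$ and $b_n\le a_n$ for all $n$, then $(b_n)_n\in I$; (iv) if $(a_n)_n\in I$ and $(b_n)_n\in I$, then $(a_n\vee b_n)_n\in I$; (v) every infinite antichain, enumerated without repetition as $(a_n)_n$, is in $I$. The ideal $I$ is uniformly Fréchet if there are functions $F_k$ $(k\in\mathbb N)$, each assigning to every infinite sequence in $B$ one of its terms, such that $(F_k(x^k))_k\in I$ whenever $x^k=(x^k_n)_n\in I$ for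 all $k$. $B$ is $I$-concentrated if for every sequence $(A_n)_{n\ge1}$ of finite antichains with $|A_n|\ge n$ there are $a_n\in A_n$ $(n\ge 1)$ with $(a_n)_n\in I$. **Theorem.** $B$ carries a strictly positive finitely additive measure if and only if there is a uniformly Fréchet convergence ideal $I$ on $B$ such that $B$ is $I$-concentrated. -/

import Mathlib

/-- A submeasure on a Boolean algebra: a normalised, monotone, subadditive real function. -/
structure IsSubmeasure {B : Type*} [BooleanAlgebra B] (m : B → ℝ) : Prop where
  map_bot : m ⊥ = 0
  map_top : m ⊤ = 1
  mono : ∀ a b, a ≤ b → m a ≤ m b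
  sup_le : ∀ a b, m (a ⊔ b) ≤ m a + m b

/-- A finitely additive measure: a submeasure that is additive on disjoint pairs. -/
structure IsFinAddMeasure {B : Type*} [BooleanAlgebra B] (m : B → ℝ) : Prop
    extends IsSubmeasure m where
  sup_eq : ∀ a b, Disjoint a b → m (a ⊔ b) = m a + m b

/-- Strict positivity of a submeasure: `m` vanishes only at the zero element. -/
def VanishesOnlyAtBot {B : Type*} [BooleanAlgebra B] (m : B → ℝ) : Prop :=
  ∀ a, m a = 0 → a = ⊥

/-- An antichain in a Boolean algebra: any two distinct elements are disjoint
(this is not the order-theoretic `IsAntichain`). -/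
def IsDisjointAntichain {B : Type*} [BooleanAlgebra B] (A : Set B) : Prop :=
  A.Pairwise Disjoint

/-- A convergence ideal: a set `I` of infinite sequences, thought of as the sequences
that converge to zero. -/
structure IsConvergenceIdeal {B : Type*} [BooleanAlgebra B] (I : Set (ℕ → B)) : Prop where
  /-- The meet of a sequence in `I` is zero. -/
  eq_bot_of_le : ∀ s ∈ I, ∀ a, (∀ n, a ≤ s n) → a = ⊥
  /-- Closure under infinite subsequences. -/
  subseq_mem : ∀ s ∈ I, ∀ φ : ℕ → ℕ, StrictMono φ → s ∘ φ ∈ I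
  /-- Closure under termwise smaller sequences. -/
  mem_of_le : ∀ s ∈ I, ∀ t : ℕ → B, (∀ n, t n ≤ s n) → t ∈ I
  /-- Closure under termwise joins. -/
  sup_mem : ∀ s ∈ I, ∀ t ∈ I, (fun n => s n ⊔ t n) ∈ I
  /-- Every enumeration without repetition of an infinite antichain is in `I`. -/
  antichain_mem : ∀ s : ℕ → B, Function.Injective s → IsDisjointAntichain (Set.range s) → s ∈ I

/-- `I` is uniformly Fréchet: there are choice functions `F k`, each picking a term of every
infinite sequence, such that whenever all the sequences `x k` are in `I`, so is the sequence
whose `k`-th term is the term of `x k` picked by `F k`. -/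
def IsUniformlyFrechet {B : Type*} [BooleanAlgebra B] (I : Set (ℕ → B)) : Prop :=
  ∃ F : ℕ → (ℕ → B) → B, (∀ k x, F k x ∈ Set.range x) ∧
    ∀ x : ℕ → ℕ → B, (∀ k, x k ∈ I) → (fun k => F k (x k)) ∈ I

/-- `B` is `I`-concentrated: from finite antichains `A₁, A₂, …` with `|Aₙ| ≥ n` one can pick
`aₙ ∈ Aₙ` such that the sequence of the `aₙ` is in `I`. As sequences are indexed by `ℕ`, the
antichain `Aₙ` is `A (n - 1)` here. -/
def IsConcentrated {B : Type*} [BooleanAlgebra B] (I : Set (ℕ → B)) : Prop :=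
  ∀ A : ℕ → Finset B, (∀ n, IsDisjointAntichain (A n : Set B)) → (∀ n, n + 1 ≤ (A n).card) →
    ∃ a ∈ I, ∀ n, a n ∈ A n

/-! Given a measure, take for `I` the sequences whose measure tends to zero; among n disjoint
elements one has measure at most 1/n.

Conversely, the choice functions turn `I` into a decreasing sequence of sets `V k` such that members
of `I` are eventually in each `V k`, while every sequence with k-th term in `V k` belongs to `I`. By
concentration, a large antichain meets `V k`. No submeasure is built from the `V k`: the
Kalton–Roberts argument applies to them directly. It shows that among finitely many elements outside
`V k` a fixed proportion has nonzero meet: otherwise, sparse bipartite graphs with Hall's property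
cut each element into three pieces and yield a large antichain missing a smaller neighbourhood. By
Kelley's criterion (Hahn–Banach) some measure is positive outside `V k`, and a countable mixture of
these is strictly positive. -/

section Convergence

open Filter Topology

/-! ### Sequences of measure tending to zero -/

namespace IsFinAddMeasure

variable {B : Type*} [BooleanAlgebra B] {m : B → ℝ}

theorem nonneg (hm : IsFinAddMeasure m) (a : B) : 0 ≤ m a :=
  hm.map_bot ▸ hm.mono ⊥ a bot_le

theorem le_one (hm : IsFinAddMeasure m) (a : B) : m a ≤ 1 :=
  hm.map_top ▸ hm.mono a ⊤ le_top

theorem sum_eq_map_sup (hm : IsFinAddMeasure m) {ι : Type*} (s : Finset ι) (f : ι → B)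
    (hf : (s : Set ι).PairwiseDisjoint f) : ∑ i ∈ s, m (f i) = m (s.sup f) := by
  classical
  induction s using Finset.induction_on with
  | empty => simp [hm.map_bot]
  | insert a s ha ih =>
    rw [Finset.sum_insert ha, Finset.sup_insert, hm.sup_eq, ih]
    · exact hf.subset (by simp)
    · rw [Finset.disjoint_sup_right]
      intro i hi
      exact hf (by simp) (by simp [hi]) (by rintro rfl; exact ha hi)

theorem sum_le_one (hm : IsFinAddMeasure m) {ι : Type*} (s : Finset ι) (f : ι → B)
    (hf : (s : Set ι).PairwiseDisjoint f) : ∑ i ∈ s, m (f i) ≤ 1 :=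
  (hm.sum_eq_map_sup s f hf).trans_le (hm.le_one _)

theorem isConvergenceIdeal (hm : IsFinAddMeasure m) (hpos : VanishesOnlyAtBot m) :
    IsConvergenceIdeal {s : ℕ → B | Tendsto (fun n => m (s n)) atTop (𝓝 0)} where
  eq_bot_of_le s hs a ha :=
    hpos a <| le_antisymm (ge_of_tendsto' hs fun n => hm.mono _ _ (ha n)) (hm.nonneg a)
  subseq_mem s hs φ hφ := by
    have h : Tendsto (fun n => m (s n)) atTop (𝓝 0) := hs
    exact h.comp hφ.tendsto_atTop
  mem_of_le s hs t ht := squeeze_zero (fun n => hm.nonneg _) (fun n => hm.mono _ _ (ht n)) hs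
  sup_mem s hs t ht := by
    refine squeeze_zero (fun n => hm.nonneg _) (fun n => hm.sup_le _ _) ?_
    simpa using Tendsto.add hs ht
  antichain_mem s hs hd := by
    refine (summable_of_sum_le (c := 1) (fun n => hm.nonneg (s n)) fun u => ?_).tendsto_atTop_zero
    refine hm.sum_le_one u s fun i _ j _ hij => ?_
    exact hd ⟨i, rfl⟩ ⟨j, rfl⟩ (hs.ne hij)

theorem isUniformlyFrechet (hm : IsFinAddMeasure m) :
    IsUniformlyFrechet {s : ℕ → B | Tendsto (fun n => m (s n)) atTop (𝓝 0)} := by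
  classical
  -- The default `x 0` is never used for a sequence in the ideal.
  refine ⟨fun k x => if h : ∃ n, m (x n) < 1 / ((k : ℝ) + 1) then x h.choose else x 0,
    fun k x => ?_, fun x hx => ?_⟩
  · dsimp only
    split_ifs <;> exact ⟨_, rfl⟩
  · refine squeeze_zero (fun n => hm.nonneg _) (fun k => ?_) tendsto_one_div_add_atTop_nhds_zero_nat
    have h : ∃ n, m (x k n) < 1 / ((k : ℝ) + 1) :=
      ((tendsto_order.1 (hx k)).2 _ (by positivity)).exists
    dsimp only
    rw [dif_pos h]
    exact h.choose_spec.le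

theorem isConcentrated (hm : IsFinAddMeasure m) :
    IsConcentrated {s : ℕ → B | Tendsto (fun n => m (s n)) atTop (𝓝 0)} := by
  intro A hA hcard
  have key : ∀ n, ∃ a ∈ A n, m a ≤ 1 / ((n : ℝ) + 1) := by
    intro n
    by_contra! h
    have hne : (A n).Nonempty := Finset.card_pos.1 (by have := hcard n; omega)
    have h1 := Finset.sum_lt_sum_of_nonempty hne h
    have h2 := hm.sum_le_one (A n) id (hA n)
    have h3 : ((n : ℝ) + 1) ≤ (A n).card := by exact_mod_cast hcard n
    rw [Finset.sum_const, nsmul_eq_mul, mul_one_div] at h1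
    have h4 : (1 : ℝ) ≤ (A n).card / ((n : ℝ) + 1) := by
      rwa [one_le_div (by positivity)]
    simp only [id] at h2
    linarith
  choose a ha hma using key
  exact ⟨a, squeeze_zero (fun n => hm.nonneg _) hma tendsto_one_div_add_atTop_nhds_zero_nat, ha⟩

end IsFinAddMeasure

/-! ### From a convergence ideal to neighbourhoods of zero -/

/-- A decreasing sequence of lower sets that behaves like a base of neighbourhoods of zero for a
uniformly exhaustive submeasure. -/
structure IsExhaustiveBase {B : Type*} [BooleanAlgebra B] (V : ℕ → Set B) : Prop where
  anti : Antitone V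
  bot_mem : ∀ k, ⊥ ∈ V k
  eq_bot : ∀ a, (∀ k, a ∈ V k) → a = ⊥
  sup_mem : ∀ k, ∃ l, ∀ a ∈ V l, ∀ b ∈ V l, a ⊔ b ∈ V k
  meets : ∀ k, ∃ r : ℕ, ∀ A : Finset B, IsDisjointAntichain (A : Set B) → r < A.card →
    ∃ a ∈ A, a ∈ V k

/-- Each axiom holds by contradiction: counterexamples chosen for every index form a sequence in
`I`, whose terms must eventually enter `V k`. -/
theorem IsConvergenceIdeal.exists_isExhaustiveBase {B : Type*} [BooleanAlgebra B]
    {I : Set (ℕ → B)} (hI : IsConvergenceIdeal I) (hF : IsUniformlyFrechet I)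
    (hc : IsConcentrated I) : ∃ V : ℕ → Set B, IsExhaustiveBase V := by
  -- With `I` empty, the sets `V k` below would not contain `⊥`; concentration then bounds the size
  -- of antichains, so `{⊥}` serves.
  rcases I.eq_empty_or_nonempty with rfl | ⟨s₀, hs₀⟩
  · refine ⟨fun _ => {⊥}, fun _ _ _ => le_rfl, fun _ => rfl, fun a ha => ha 0,
      fun k => ⟨0, ?_⟩, fun k => ?_⟩
    · rintro a rfl b rfl
      simp
    · by_contra! h
      choose A hA hcard _ using h
      obtain ⟨a, ha, -⟩ := hc A hA hcard
      exact ha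
  obtain ⟨F, hFr, hF⟩ := hF
  set V : ℕ → Set B := fun k => {b | ∀ j ≤ k, ∃ x ∈ I, b ≤ F j x} with hV
  have memI : ∀ s : ℕ → B, (∀ k, s k ∈ V k) → s ∈ I := by
    intro s hs
    choose x hx hle using fun k => hs k k le_rfl
    exact hI.mem_of_le _ (hF x hx) s hle
  have bot : ∀ k, ⊥ ∈ V k := fun k j _ => ⟨s₀, hs₀, bot_le⟩
  have ev : ∀ s ∈ I, ∀ k, ∀ᶠ n in atTop, s n ∈ V k := by
    intro s hs k
    have h : ∀ j ∈ Set.Iic k, ∀ᶠ n in atTop, ∃ x ∈ I, s n ≤ F j x := by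
      intro j _
      -- The terms violating the claim would form a subsequence in `I`, and `F j` picks one of them.
      by_contra hj
      obtain ⟨φ, hφ, hn⟩ := extraction_of_frequently_atTop (not_eventually.1 hj)
      obtain ⟨n, hn'⟩ := hFr j (s ∘ φ)
      exact hn n ⟨s ∘ φ, hI.subseq_mem s hs φ hφ, hn'.le⟩
    exact (eventually_all_finite (Set.finite_Iic k)).2 h
  refine ⟨V, fun k l hkl b hb j hj => hb j (hj.trans hkl), bot, fun a ha => ?_, fun k => ?_,
    fun k => ?_⟩
  · exact hI.eq_bot_of_le (fun _ => a) (memI _ ha) a fun _ => le_rfl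
  · by_contra! h
    choose a ha b hb hab using h
    obtain ⟨n, hn⟩ := (ev _ (hI.sup_mem a (memI a ha) b (memI b hb)) k).exists
    exact hab n hn
  · by_contra! h
    choose A hA hcard hn using h
    obtain ⟨a, ha, haA⟩ := hc A hA hcard
    obtain ⟨n, hn'⟩ := (ev a ha k).exists
    exact hn n _ (haA n) hn'

end Convergence

/-! ### Concentrators by counting -/

theorem pow_self_le_three_pow_mul_factorial (s : ℕ) :
    (s : ℝ) ^ s ≤ 3 ^ s * (s.factorial : ℝ) := by
  have h1 := Real.pow_div_factorial_le_exp (s : ℝ) (by positivity) s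
  rw [div_le_iff₀ (by positivity)] at h1
  refine h1.trans (mul_le_mul_of_nonneg_right ?_ (by positivity))
  rw [← mul_one (s : ℝ), Real.exp_nat_mul]
  exact pow_le_pow_left₀ (Real.exp_pos _).le (Real.exp_one_lt_d9.le.trans (by norm_num)) _

/-- Each of the two factorials costs a factor `3 ^ s`; the 18 is 2 · 3 · 3, the 2 providing the
ratio 1/2. -/
theorem choose_mul_choose_mul_pow_le {l m s : ℕ} (h : 18 * m * s ≤ l ^ 2) :
    ((m.choose s * l.choose s * s ^ (3 * s) : ℕ) : ℝ) ≤ (l : ℝ) ^ (3 * s) * (1 / 2) ^ s := by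
  have hm : (m.choose s : ℝ) ≤ (m : ℝ) ^ s / s.factorial := Nat.choose_le_pow_div s m
  have hl : (l.choose s : ℝ) ≤ (l : ℝ) ^ s / s.factorial := Nat.choose_le_pow_div s l
  have hs := pow_self_le_three_pow_mul_factorial s
  have hs' : (s : ℝ) ^ s / s.factorial ≤ 3 ^ s := by
    rwa [div_le_iff₀ (by positivity)]
  have h' : (18 : ℝ) * m * s ≤ (l : ℝ) ^ 2 := by exact_mod_cast h
  push_cast
  calc (m.choose s * l.choose s * (s : ℝ) ^ (3 * s) : ℝ)
      ≤ ((m : ℝ) ^ s / s.factorial) * ((l : ℝ) ^ s / s.factorial) * (s : ℝ) ^ (3 * s) := by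
        gcongr
    _ = (m : ℝ) ^ s * (l : ℝ) ^ s * (s : ℝ) ^ s *
          (((s : ℝ) ^ s / s.factorial) * ((s : ℝ) ^ s / s.factorial)) := by
        rw [pow_mul' (s : ℝ)]; ring
    _ ≤ (m : ℝ) ^ s * (l : ℝ) ^ s * (s : ℝ) ^ s * (3 ^ s * 3 ^ s) := by gcongr
    _ = ((l : ℝ) * (9 * m * s)) ^ s := by
        simp only [mul_pow]
        rw [show (9 : ℝ) = 3 * 3 by norm_num, mul_pow]; ring
    _ ≤ ((l : ℝ) ^ 3 * (1 / 2)) ^ s := by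
        refine pow_le_pow_left₀ (by positivity) ?_ _
        have : (0 : ℝ) ≤ l := by positivity
        nlinarith
    _ = (l : ℝ) ^ (3 * s) * (1 / 2) ^ s := by rw [mul_pow, ← pow_mul]

open Finset in
/-- The number of bipartite graphs with prescribed degree three whose neighbourhood of `E` is
contained in `F`. -/
theorem card_filter_forall_mem {M L : Type*} [Fintype M] [Fintype L] [DecidableEq M]
    [DecidableEq L] (E : Finset M) (F : Finset L) :
    #{g : M → Fin 3 → L | ∀ x ∈ E, ∀ j, g x j ∈ F} =
      #F ^ (3 * #E) * Fintype.card L ^ (3 * (Fintype.card M - #E)) := by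
  have h : ({g : M → Fin 3 → L | ∀ x ∈ E, ∀ j, g x j ∈ F} : Finset _) =
      Fintype.piFinset fun x => Fintype.piFinset fun _ : Fin 3 => if x ∈ E then F else univ := by
    ext g
    simp only [mem_filter, mem_univ, true_and, Fintype.mem_piFinset]
    refine forall_congr' fun x => ?_
    by_cases hx : x ∈ E <;> simp [hx]
  rw [h, Fintype.card_piFinset]
  simp only [Fintype.card_piFinset, prod_const, card_univ, Fintype.card_fin]
  have h2 : ∀ x, #(if x ∈ E then F else univ) ^ 3 =
      if x ∈ E then #F ^ 3 else Fintype.card L ^ 3 := by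
    intro x
    split_ifs <;> simp
  simp only [h2]
  rw [prod_ite, prod_const, prod_const, pow_mul, pow_mul, filter_mem_eq_inter, univ_inter,
    filter_not, filter_mem_eq_inter, univ_inter, ← compl_eq_univ_sdiff, card_compl]

open Finset in
-- Union bound: a bad graph sends some `E` of size s into some `F` of the same size. The proportion
-- of such graphs is at most `(1 / 2) ^ s`, and these sum to less than 1.
theorem exists_concentrator {M L : Type*} [Fintype M] [Fintype L] [DecidableEq M]
    [DecidableEq L] [Nonempty L] (k : ℕ) (h : 18 * Fintype.card M * k ≤ Fintype.card L ^ 2) :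
    ∃ g : M → Fin 3 → L, ∀ E : Finset M, #E ≤ k → #E ≤ #(E.biUnion fun x => univ.image (g x)) := by
  set m := Fintype.card M with hm
  set l := Fintype.card L with hl
  have hl0 : 0 < l := Fintype.card_pos
  by_contra! hbad
  have hcover : (univ : Finset (M → Fin 3 → L)) ⊆ (Icc 1 k).biUnion fun s =>
      (powersetCard s (univ : Finset M) ×ˢ powersetCard s (univ : Finset L)).biUnion fun p =>
        {g | ∀ x ∈ p.1, ∀ j, g x j ∈ p.2} := by
    intro g _
    obtain ⟨E, hEk, hE⟩ := hbad g
    have hEl : #E ≤ l := by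
      have h1 : #E ≤ m := card_le_univ E
      have h2 : 18 * #E * #E ≤ l ^ 2 := le_trans (by gcongr) h
      nlinarith
    obtain ⟨F, hF1, -, hF2⟩ := exists_subsuperset_card_eq
      (subset_univ (E.biUnion fun x => univ.image (g x))) hE.le (by simpa using hEl)
    simp only [mem_biUnion, mem_Icc, mem_product, mem_powersetCard, subset_univ, true_and,
      mem_filter, mem_univ]
    refine ⟨#E, ⟨by omega, hEk⟩, (E, F), ⟨rfl, hF2⟩, fun x hx j => hF1 ?_⟩
    exact mem_biUnion.2 ⟨x, hx, mem_image_of_mem _ (mem_univ j)⟩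
  have hcard : l ^ (3 * m) ≤ ∑ s ∈ Icc 1 k,
      (m.choose s * l.choose s) * (s ^ (3 * s) * l ^ (3 * (m - s))) := by
    have h1 := card_le_card hcover
    rw [card_univ, Fintype.card_fun, Fintype.card_fun, Fintype.card_fin, ← pow_mul] at h1
    refine h1.trans (card_biUnion_le.trans (sum_le_sum fun s _ => ?_))
    refine (card_biUnion_le_card_mul _ _ (s ^ (3 * s) * l ^ (3 * (m - s))) ?_).trans ?_
    · intro p hp
      simp only [mem_product, mem_powersetCard] at hp
      rw [card_filter_forall_mem, hp.1.2, hp.2.2]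
    · rw [card_product, card_powersetCard, card_powersetCard, card_univ, card_univ]
  have hterm : ∀ s ∈ Icc 1 k,
      (((m.choose s * l.choose s) * (s ^ (3 * s) * l ^ (3 * (m - s))) : ℕ) : ℝ) ≤
        (l : ℝ) ^ (3 * m) * (1 / 2) ^ s := by
    intro s hs
    rcases lt_or_ge m s with hms | hms
    · rw [Nat.choose_eq_zero_of_lt hms]
      simp only [zero_mul, Nat.cast_zero]
      positivity
    · have hb := choose_mul_choose_mul_pow_le (l := l) (m := m) (s := s)
        (le_trans (Nat.mul_le_mul_left _ (mem_Icc.1 hs).2) h)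
      rw [← mul_assoc, Nat.cast_mul]
      calc _ ≤ (l : ℝ) ^ (3 * s) * (1 / 2) ^ s * ((l ^ (3 * (m - s)) : ℕ) : ℝ) := by gcongr
        _ = (l : ℝ) ^ (3 * m) * (1 / 2) ^ s := by
          rw [show 3 * m = 3 * s + 3 * (m - s) by omega, pow_add]
          push_cast
          ring
  have hsum : ∑ s ∈ Icc 1 k, (1 / 2 : ℝ) ^ s < 1 := by
    have : ∀ k : ℕ, ∑ s ∈ Icc 1 k, (1 / 2 : ℝ) ^ s = 1 - (1 / 2) ^ k := by
      intro k
      induction k with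
      | zero => simp
      | succ k ih => rw [sum_Icc_succ_top (by omega), ih]; ring
    rw [this]
    linarith [pow_pos (by norm_num : (0 : ℝ) < 1 / 2) k]
  have hfin : (l : ℝ) ^ (3 * m) ≤ (l : ℝ) ^ (3 * m) * ∑ s ∈ Icc 1 k, (1 / 2 : ℝ) ^ s := by
    rw [mul_sum]
    refine le_trans ?_ (sum_le_sum hterm)
    exact_mod_cast hcard
  have hpos : (0 : ℝ) < (l : ℝ) ^ (3 * m) := by positivity
  nlinarith

/-! ### Stone representation -/

/-- The Stone representation of a Boolean algebra by sets of prime ideals. -/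
def stoneRepr (B : Type*) [BooleanAlgebra B] :
    BoundedLatticeHom B (Set {P : Order.Ideal B // P.IsPrime}) where
  toFun a := {P | a ∉ P.1}
  map_sup' a b := by
    ext P
    exact (not_congr Order.Ideal.sup_mem_iff).trans not_and_or
  map_inf' a b := by
    ext P
    refine ⟨fun h => ⟨fun ha => h (P.1.lower inf_le_left ha),
      fun hb => h (P.1.lower inf_le_right hb)⟩, fun h hab => ?_⟩
    exact (P.2.mem_or_mem hab).elim h.1 h.2
  map_top' := by
    ext P
    simp [P.2.toIsProper.top_notMem]
  map_bot' := by
    ext P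
    simp

theorem stoneRepr_nonempty {B : Type*} [BooleanAlgebra B] {a : B} (ha : a ≠ ⊥) :
    (stoneRepr B a).Nonempty := by
  have hd : Disjoint (Order.PFilter.principal a : Set B)
      (Order.Ideal.principal (⊥ : B) : Set B) := by
    rw [Set.disjoint_left]
    intro x hx hx'
    exact ha (le_bot_iff.1 (le_trans (Order.PFilter.mem_principal.1 hx)
      (Order.Ideal.mem_principal.1 hx')))
  obtain ⟨P, hP, -, hPF⟩ := DistribLattice.prime_ideal_of_disjoint_filter_ideal hd
  exact ⟨⟨P, hP⟩, Set.disjoint_left.1 hPF (Order.PFilter.mem_principal.2 le_rfl)⟩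

theorem stoneRepr_injective (B : Type*) [BooleanAlgebra B] :
    Function.Injective (stoneRepr B) := by
  have key : ∀ a b : B, stoneRepr B a ⊆ stoneRepr B b → a ≤ b := by
    intro a b h
    by_contra hab
    obtain ⟨P, hP⟩ := stoneRepr_nonempty (a := a ⊓ bᶜ)
      (fun h' => hab (by rwa [← sdiff_eq, sdiff_eq_bot_iff] at h'))
    rw [map_inf] at hP
    have h1 : P ∈ stoneRepr B (b ⊓ bᶜ) := by
      rw [map_inf]
      exact ⟨h hP.1, hP.2⟩
    rw [inf_compl_self, map_bot] at h1
    exact h1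
  exact fun a b h => le_antisymm (key a b h.le) (key b a h.ge)

theorem mem_stoneRepr_compl {B : Type*} [BooleanAlgebra B] (a : B)
    (P : {P : Order.Ideal B // P.IsPrime}) : P ∈ stoneRepr B aᶜ ↔ P ∉ stoneRepr B a := by
  rw [map_compl']
  rfl

theorem mem_stoneRepr_finset_inf {B : Type*} [BooleanAlgebra B] {ι : Type*} (s : Finset ι)
    (f : ι → B) (P : {P : Order.Ideal B // P.IsPrime}) :
    P ∈ stoneRepr B (s.inf f) ↔ ∀ i ∈ s, P ∈ stoneRepr B (f i) := by
  rw [map_finset_inf, Finset.inf_eq_iInf]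
  simp

theorem mem_stoneRepr_finset_sup {B : Type*} [BooleanAlgebra B] {ι : Type*} (s : Finset ι)
    (f : ι → B) (P : {P : Order.Ideal B // P.IsPrime}) :
    P ∈ stoneRepr B (s.sup f) ↔ ∃ i ∈ s, P ∈ stoneRepr B (f i) := by
  rw [map_finset_sup, Finset.sup_eq_iSup]
  simp

/-! ### Kalton–Roberts argument -/

open Finset in
/-- A concentrator matches every small enough set of left vertices into the right vertices. -/
theorem exists_concentrator_matching {M L : Type*} [Fintype M] [Fintype L] [DecidableEq M]
    [DecidableEq L] [Nonempty L] (k : ℕ) (h : 18 * Fintype.card M * k ≤ Fintype.card L ^ 2) :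
    ∃ (g : M → Fin 3 → L) (f : Finset M → M → L), ∀ E : Finset M, #E ≤ k →
      Set.InjOn (f E) E ∧ ∀ x ∈ E, ∃ j, g x j = f E x := by
  obtain ⟨g, hg⟩ := exists_concentrator (M := M) (L := L) k h
  have key : ∀ E : Finset M, ∃ f : M → L, #E ≤ k →
      Set.InjOn f E ∧ ∀ x ∈ E, ∃ j, g x j = f x := by
    intro E
    by_cases hE : #E ≤ k
    -- Hall's theorem: subsets of `E` also have at most `k` elements.
    · obtain ⟨f, hf, hfg⟩ := (Finset.all_card_le_biUnion_card_iff_exists_injective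
        (fun x : E => univ.image (g x))).1 fun s => by
          have := hg (s.map (Function.Embedding.subtype _))
            ((card_le_card (map_subtype_subset s)).trans hE)
          rw [card_map] at this
          refine this.trans (card_le_card ?_)
          intro y
          simp
      refine ⟨fun x => if hx : x ∈ E then f ⟨x, hx⟩ else Classical.arbitrary L, fun _ =>
        ⟨fun x hx y hy hxy => ?_, fun x hx => ?_⟩⟩
      · have hx' : x ∈ E := hx
        have hy' : y ∈ E := hy
        simp only [hx', hy', dif_pos] at hxy
        exact congrArg Subtype.val (hf hxy)
      · simpa [hx] using hfg ⟨x, hx⟩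
    · exact ⟨fun _ => Classical.arbitrary L, fun h => absurd h hE⟩
  choose f hf using key
  exact ⟨g, f, hf⟩

open Finset in
/-- The combinatorial core of the Kalton–Roberts theorem. -/
theorem exists_inf_ne_bot_of_concentrator {B : Type*} [BooleanAlgebra B] {V W : Set B}
    (hW : ∀ a ∈ W, ∀ b ∈ W, ∀ c ∈ W, a ⊔ b ⊔ c ∈ V) (hbot : ⊥ ∈ W) {r : ℕ}
    (hr : ∀ A : Finset B, IsDisjointAntichain (A : Set B) → r < #A → ∃ a ∈ A, a ∈ W)
    {M L : Type*} [Fintype M] [Fintype L] [DecidableEq M] [DecidableEq L] [Nonempty L] {k : ℕ}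
    (h : 18 * Fintype.card M * k ≤ Fintype.card L ^ 2) (hlm : Fintype.card L * r < Fintype.card M)
    (b : M → B) (hb : ∀ x, b x ∉ V) : ∃ J : Finset M, k < #J ∧ J.inf b ≠ ⊥ := by
  classical
  by_contra! hJ
  obtain ⟨g, f, hgf⟩ := exists_concentrator_matching (M := M) (L := L) k h
  -- The points of `e E` lie in `b x` exactly for the `x` in `E`; `c x y` is the part of `b x` where
  -- `x` is matched to `y`.
  let e : Finset M → B := fun E => E.inf b ⊓ Eᶜ.inf fun x => (b x)ᶜ
  let c : M → L → B := fun x y => ({E | x ∈ E ∧ f E x = y} : Finset (Finset M)).sup e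
  let T : {P : Order.Ideal B // P.IsPrime} → Finset M := fun P => {x | P ∈ stoneRepr B (b x)}
  have mem_T : ∀ P x, x ∈ T P ↔ P ∈ stoneRepr B (b x) := fun P x => by simp [T]
  have card_T : ∀ P, #(T P) ≤ k := by
    intro P
    by_contra! hk
    have h1 : P ∈ stoneRepr B ((T P).inf b) :=
      (mem_stoneRepr_finset_inf _ _ _).2 fun x hx => (mem_T P x).1 hx
    rw [hJ _ hk, map_bot] at h1
    exact h1
  have mem_e : ∀ P E, P ∈ stoneRepr B (e E) ↔ E = T P := by
    intro P E
    simp only [e, map_inf, Set.inf_eq_inter, Set.mem_inter_iff, mem_stoneRepr_finset_inf,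
      mem_stoneRepr_compl, mem_compl, Finset.ext_iff, mem_T]
    refine ⟨fun hE x => ⟨hE.1 x, fun hx => ?_⟩, fun hE => ⟨fun x => (hE x).1,
      fun x => mt (hE x).2⟩⟩
    by_contra hxE
    exact hE.2 x hxE hx
  have mem_c : ∀ P x y, P ∈ stoneRepr B (c x y) ↔ x ∈ T P ∧ f (T P) x = y := by
    intro P x y
    simp only [c, mem_stoneRepr_finset_sup, mem_e, mem_filter, mem_univ, true_and]
    exact ⟨by rintro ⟨E, hE, rfl⟩; exact hE, fun hE => ⟨_, hE, rfl⟩⟩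
  have hcb : ∀ x, ∃ j, c x (g x j) ∉ W := by
    intro x
    by_contra! hc
    refine hb x ?_
    have : b x = c x (g x 0) ⊔ c x (g x 1) ⊔ c x (g x 2) := by
      apply stoneRepr_injective B
      ext P
      simp only [map_sup, Set.sup_eq_union, Set.mem_union, mem_c, ← mem_T]
      refine ⟨fun hx => ?_, by rintro ((h | h) | h) <;> exact h.1⟩
      obtain ⟨j, hj⟩ := (hgf (T P) (card_T P)).2 x hx
      fin_cases j
      · exact Or.inl (Or.inl ⟨hx, hj.symm⟩)
      · exact Or.inl (Or.inr ⟨hx, hj.symm⟩)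
      · exact Or.inr ⟨hx, hj.symm⟩
    rw [this]
    exact hW _ (hc 0) _ (hc 1) _ (hc 2)
  choose j hj using hcb
  -- By pigeonhole more than `r` vertices have a piece outside `W` with the same label `y`;
  -- injectivity of the matchings makes these pieces disjoint.
  obtain ⟨y, hy⟩ := Fintype.exists_lt_card_fiber_of_mul_lt_card (fun x => g x (j x)) hlm
  have hcd : ∀ x x', x ≠ x' → Disjoint (c x y) (c x' y) := by
    intro x x' hne
    rw [disjoint_iff]
    apply stoneRepr_injective B
    ext P
    simp only [map_inf, map_bot, Set.inf_eq_inter, Set.mem_inter_iff, mem_c, Set.bot_eq_empty,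
      Set.mem_empty_iff_false, iff_false]
    rintro ⟨⟨hx, hxy⟩, hx', hxy'⟩
    exact hne ((hgf (T P) (card_T P)).1 hx hx' (hxy.trans hxy'.symm))
  have hcW : ∀ x ∈ ({x | g x (j x) = y} : Finset M), c x y ∉ W := by
    intro x hx
    rw [← (mem_filter.1 hx).2]
    exact hj x
  obtain ⟨a, ha, haW⟩ := hr (({x | g x (j x) = y} : Finset M).image fun x => c x y) (by
      rintro a ha a' ha' hne
      obtain ⟨x, -, rfl⟩ := mem_image.1 (mem_coe.1 ha)
      obtain ⟨x', -, rfl⟩ := mem_image.1 (mem_coe.1 ha')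
      exact hcd x x' (by rintro rfl; exact hne rfl)) (by
      rwa [card_image_of_injOn]
      intro x hx x' hx' hxx'
      by_contra hne
      have h1 := hcd x x' hne
      dsimp only at hxx'
      rw [← hxx', disjoint_self] at h1
      exact hcW x hx (h1 ▸ hbot))
  obtain ⟨x, hx, rfl⟩ := mem_image.1 ha
  exact hcW x hx haW

open Finset in
/-- Elements outside a neighbourhood of zero have positive intersection number. -/
theorem exists_card_le_mul_card_inf_ne_bot {B : Type*} [BooleanAlgebra B] {V W : Set B}
    (hW : ∀ a ∈ W, ∀ b ∈ W, ∀ c ∈ W, a ⊔ b ⊔ c ∈ V) (hbot : ⊥ ∈ W) {r : ℕ}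
    (hr : ∀ A : Finset B, IsDisjointAntichain (A : Set B) → r < #A → ∃ a ∈ A, a ∈ W)
    {ι : Type*} [Fintype ι] [Nonempty ι] (a : ι → B) (ha : ∀ i, a i ∉ V) :
    ∃ J : Finset ι, Fintype.card ι ≤ 18 * (r + 1) ^ 2 * #J ∧ J.inf a ≠ ⊥ := by
  classical
  set m := Fintype.card ι with hm
  have hm0 : 0 < m := Fintype.card_pos
  have hdiv : 18 * (r + 1) * (m / (18 * (r + 1))) ≤ m := Nat.mul_div_le _ _
  have hlt : m < 18 * (r + 1) * (m / (18 * (r + 1)) + 1) := Nat.lt_mul_div_succ _ (by positivity)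
  -- Repeating each element `r + 1` times makes the left side larger than `r` times the right;
  -- projecting `J` back loses at most that factor.
  obtain ⟨J, hJ, hJa⟩ := exists_inf_ne_bot_of_concentrator hW hbot hr (M := ι × Fin (r + 1))
    (L := ι) (k := m / (18 * (r + 1)))
    (by
      rw [Fintype.card_prod, Fintype.card_fin, ← hm]
      nlinarith)
    (by
      rw [Fintype.card_prod, Fintype.card_fin, ← hm]
      nlinarith) (fun x => a x.1) (fun x => ha x.1)
  refine ⟨J.image Prod.fst, ?_, ?_⟩
  · have h1 : #J ≤ #(J.image Prod.fst) * (r + 1) := by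
      have h2 : J ⊆ J.image Prod.fst ×ˢ univ := fun x hx => by
        simpa using ⟨x.2, hx⟩
      simpa using card_le_card h2
    calc m ≤ 18 * (r + 1) * (m / (18 * (r + 1)) + 1) := hlt.le
      _ ≤ 18 * (r + 1) * (#(J.image Prod.fst) * (r + 1)) := by gcongr; omega
      _ = _ := by ring
  · rw [inf_image]
    exact hJa

/-! ### Kelley's criterion -/

open Finset in
/-- The intersection number bounds the maximum of any convex combination of members of the family
from below. -/
theorem one_le_mul_of_convexCombination_le {B : Type*} [BooleanAlgebra B] {A : Set B} {N : ℕ}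
    (h : ∀ (ι : Type) [Fintype ι] [Nonempty ι] (a : ι → B), (∀ i, a i ∈ A) →
      ∃ J : Finset ι, Fintype.card ι ≤ N * #J ∧ J.inf a ≠ ⊥)
    {ι : Type} [Fintype ι] (w : ι → ℝ) (hw : ∀ i, 0 ≤ w i) (hw1 : ∑ i, w i = 1) (a : ι → B)
    (ha : ∀ i, a i ∈ A) {η : ℝ}
    (hη : ∀ P, ∑ i, w i * (stoneRepr B (a i)).indicator 1 P ≤ η) : 1 ≤ N * η := by
  classical
  -- Weights are replaced by multiplicities `⌈K * w i⌉₊`; the rounding error, at most the number of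
  -- indices, is negligible for large `K`.
  have key : ∀ K : ℕ, 0 < K → (K : ℝ) ≤ N * (K * η + Fintype.card ι) := by
    intro K hK
    let n : ι → ℕ := fun i => ⌈K * w i⌉₊
    have hn : (K : ℝ) ≤ Fintype.card (Σ i, Fin (n i)) := by
      rw [Fintype.card_sigma]
      push_cast
      calc (K : ℝ) = ∑ i, K * w i := by rw [← mul_sum, hw1, mul_one]
        _ ≤ _ := by
          refine sum_le_sum fun i _ => ?_
          rw [Fintype.card_fin]
          exact Nat.le_ceil _
    have : Nonempty (Σ i, Fin (n i)) := by
      rw [← Fintype.card_pos_iff]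
      have : (0 : ℝ) < K := by exact_mod_cast hK
      exact_mod_cast this.trans_le hn
    obtain ⟨J, hJ, hJa⟩ := h (Σ i, Fin (n i)) (fun x => a x.1) fun x => ha x.1
    obtain ⟨P, hP⟩ := stoneRepr_nonempty hJa
    rw [mem_stoneRepr_finset_inf] at hP
    let v : B → ℝ := fun b => (stoneRepr B b).indicator 1 P
    have v_nonneg : ∀ b, 0 ≤ v b := fun b => Set.indicator_nonneg (fun _ _ => zero_le_one) _
    have v_le_one : ∀ b, v b ≤ 1 := fun b => Set.indicator_le_self' (fun _ _ => zero_le_one) _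
    have v_eq_one : ∀ x ∈ J, v (a x.1) = 1 := fun x hx => Set.indicator_of_mem (hP x hx) _
    have hJ' : (#J : ℝ) ≤ K * η + Fintype.card ι := by
      calc (#J : ℝ) = ∑ x ∈ J, v (a x.1) := by
            rw [sum_congr rfl v_eq_one]
            simp
        _ ≤ ∑ x : Σ i, Fin (n i), v (a x.1) :=
            sum_le_univ_sum_of_nonneg fun x => v_nonneg _
        _ = ∑ i, n i * v (a i) := by
            rw [Fintype.sum_sigma]
            simp
        _ ≤ ∑ i, (K * (w i * v (a i)) + 1) := by
            refine sum_le_sum fun i _ => ?_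
            have h1 : (n i : ℝ) ≤ K * w i + 1 :=
              (Nat.ceil_lt_add_one (mul_nonneg (by positivity) (hw i))).le
            nlinarith [v_nonneg (a i), v_le_one (a i)]
        _ = K * ∑ i, w i * v (a i) + Fintype.card ι := by
            rw [sum_add_distrib, ← mul_sum]
            simp
        _ ≤ _ := by
            gcongr
            exact hη P
    calc (K : ℝ) ≤ Fintype.card (Σ i, Fin (n i)) := hn
      _ ≤ N * (#J : ℝ) := by exact_mod_cast hJ
      _ ≤ _ := by gcongr
  by_contra! hlt
  obtain ⟨K, hK⟩ := exists_nat_gt (N * Fintype.card ι / (1 - N * η) : ℝ)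
  have h0 : (0 : ℝ) < 1 - N * η := by linarith
  have hK0 : (0 : ℝ) < K := lt_of_le_of_lt (by positivity) hK
  rw [div_lt_iff₀ h0] at hK
  have := key K (by exact_mod_cast hK0)
  nlinarith

open Finset BoundedContinuousFunction in
/-- Kelley's criterion: a family with positive intersection number carries a finitely additive
measure that is positive on it. -/
theorem exists_isFinAddMeasure_pos {B : Type*} [BooleanAlgebra B] {A : Set B}
    (hA : A.Nonempty) {N : ℕ} (hN : 0 < N)
    (h : ∀ (ι : Type) [Fintype ι] [Nonempty ι] (a : ι → B), (∀ i, a i ∈ A) →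
      ∃ J : Finset ι, Fintype.card ι ≤ N * #J ∧ J.inf a ≠ ⊥) :
    ∃ m : B → ℝ, IsFinAddMeasure m ∧ ∀ a ∈ A, 0 < m a := by
  let Z := {P : Order.Ideal B // P.IsPrime}
  let _ : TopologicalSpace Z := ⊥
  have : DiscreteTopology Z := ⟨rfl⟩
  let χ : B → Z →ᵇ ℝ := fun a =>
    BoundedContinuousFunction.indicator (stoneRepr B a) (isClopen_discrete _)
  have χ_apply : ∀ a P, χ a P = (stoneRepr B a).indicator 1 P := fun _ _ => rfl
  -- Functions with supremum below `1 / N`; a bound `η` uniform in `P` makes this set open.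
  let T : Set (Z →ᵇ ℝ) := {f | ∃ η : ℝ, N * η < 1 ∧ ∀ P, f P ≤ η}
  have hN' : (0 : ℝ) < N := by exact_mod_cast hN
  have T_convex : Convex ℝ T := by
    rintro f ⟨η, hη, hf⟩ g ⟨θ, hθ, hg⟩ s t hs ht hst
    refine ⟨max η θ, ?_, fun P => ?_⟩
    · rcases max_choice η θ with h | h <;> rwa [h]
    · have h1 := mul_le_mul_of_nonneg_left ((hf P).trans (le_max_left η θ)) hs
      have h2 := mul_le_mul_of_nonneg_left ((hg P).trans (le_max_right η θ)) ht
      calc (s • f + t • g) P = s * f P + t * g P := rfl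
        _ ≤ s * max η θ + t * max η θ := add_le_add h1 h2
        _ = max η θ := by rw [← add_mul, hst, one_mul]
  have T_open : IsOpen T := by
    rw [Metric.isOpen_iff]
    rintro f ⟨η, hη, hf⟩
    refine ⟨(1 - N * η) / (2 * N), div_pos (by linarith) (by positivity), fun g hg => ?_⟩
    refine ⟨η + (1 - N * η) / (2 * N), ?_, fun P => ?_⟩
    · have : (N : ℝ) * ((1 - N * η) / (2 * N)) = (1 - N * η) / 2 := by field_simp
      rw [mul_add, this]
      linarith
    · have h1 := (dist_coe_le_dist P).trans (Metric.mem_ball.1 hg).le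
      have h2 := (le_abs_self _).trans (Real.dist_eq (g P) (f P) ▸ h1)
      linarith [hf P]
  have hdisj : Disjoint T (convexHull ℝ (χ '' A)) := by
    rw [Set.disjoint_left]
    rintro f ⟨η, hη, hf⟩ hf'
    obtain ⟨ι, _, w, z, hw, hw1, hz, rfl⟩ := mem_convexHull_iff_exists_fintype.1 hf'
    choose a ha haz using hz
    refine hη.not_ge (one_le_mul_of_convexCombination_le h w hw hw1 a ha fun P => ?_)
    refine le_trans (le_of_eq ?_) (hf P)
    simp [← haz, χ_apply]
  obtain ⟨Λ, u, hT, hS⟩ := geometric_hahn_banach_open T_convex T_open (convex_convexHull _ _) hdisj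
  have hu : 0 < u := by simpa using hT 0 ⟨0, by simp, fun P => le_rfl⟩
  have Λ_nonneg : ∀ f : Z →ᵇ ℝ, (∀ P, 0 ≤ f P) → 0 ≤ Λ f := by
    intro f hf
    by_contra! hneg
    -- `T` contains every `-n • f`, and `Λ` is below `u` on `T`.
    obtain ⟨n, hn⟩ := exists_nat_gt (u / -Λ f)
    rw [div_lt_iff₀ (by linarith)] at hn
    have h1 := hT (-(n : ℝ) • f) ⟨0, by simp, fun P => by
      have := mul_nonneg (Nat.cast_nonneg (α := ℝ) n) (hf P)
      simpa using this⟩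
    rw [map_smul, smul_eq_mul] at h1
    linarith
  have Λ_mono : ∀ a b, a ≤ b → Λ (χ a) ≤ Λ (χ b) := by
    intro a b hab
    rw [← sub_nonneg, ← map_sub]
    refine Λ_nonneg _ fun P => sub_nonneg.2 ?_
    exact Set.indicator_le_indicator_of_subset (OrderHomClass.mono (stoneRepr B) hab)
      (fun _ => zero_le_one) P
  have Λ_pos : ∀ a ∈ A, 0 < Λ (χ a) := fun a ha =>
    hu.trans_le (hS _ (subset_convexHull ℝ _ ⟨a, ha, rfl⟩))
  have Λ_bot : Λ (χ ⊥) = 0 := by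
    have : χ ⊥ = 0 := by
      ext P
      rw [χ_apply, map_bot]
      exact Set.indicator_of_notMem (Set.notMem_empty P) _
    rw [this, map_zero]
  have Λ_sup : ∀ a b, Disjoint a b → Λ (χ (a ⊔ b)) = Λ (χ a) + Λ (χ b) := by
    intro a b hab
    rw [← map_add]
    congr 1
    ext P
    rw [BoundedContinuousFunction.add_apply, χ_apply, χ_apply, χ_apply, map_sup]
    exact congrFun (Set.indicator_union_of_disjoint
      (Set.disjoint_iff_inter_eq_empty.2 (by
        have h1 : stoneRepr B (a ⊓ b) = stoneRepr B a ∩ stoneRepr B b := map_inf _ _ _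
        rw [hab.eq_bot, map_bot] at h1
        exact h1.symm)) _) P
  obtain ⟨a₀, ha₀⟩ := hA
  have Λ_top : 0 < Λ (χ ⊤) := (Λ_pos a₀ ha₀).trans_le (Λ_mono _ _ le_top)
  have sup_eq : ∀ a b, Disjoint a b →
      Λ (χ (a ⊔ b)) / Λ (χ ⊤) = Λ (χ a) / Λ (χ ⊤) + Λ (χ b) / Λ (χ ⊤) := by
    intro a b hab
    rw [Λ_sup a b hab, add_div]
  have mono : ∀ a b, a ≤ b → Λ (χ a) / Λ (χ ⊤) ≤ Λ (χ b) / Λ (χ ⊤) := by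
    intro a b hab
    have := Λ_mono a b hab
    gcongr
  refine ⟨fun a => Λ (χ a) / Λ (χ ⊤), ⟨⟨by simp [Λ_bot], div_self Λ_top.ne', mono, ?_⟩, sup_eq⟩,
    fun a ha => div_pos (Λ_pos a ha) Λ_top⟩
  intro a b
  rw [← sup_sdiff_self_right, sup_eq _ _ disjoint_sdiff_self_right]
  exact add_le_add_right (mono _ _ sdiff_le) _

/-! ### Mixing the measures -/

/-- A countable mixture of finitely additive measures. -/
theorem IsFinAddMeasure.tsum_geometric {B : Type*} [BooleanAlgebra B] {μ : ℕ → B → ℝ}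
    (hμ : ∀ k, IsFinAddMeasure (μ k)) :
    IsFinAddMeasure (fun a => ∑' k, 1 / 2 / 2 ^ k * μ k a) ∧
      ∀ k a, 0 < μ k a → 0 < ∑' k, 1 / 2 / 2 ^ k * μ k a := by
  have hg : Summable fun k : ℕ => (1 / 2 / 2 ^ k : ℝ) := summable_geometric_two' 1
  have hnn : ∀ a k, 0 ≤ (1 / 2 / 2 ^ k : ℝ) * μ k a := fun a k =>
    mul_nonneg (by positivity) ((hμ k).nonneg a)
  have hs : ∀ a, Summable fun k => (1 / 2 / 2 ^ k : ℝ) * μ k a := fun a =>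
    Summable.of_nonneg_of_le (hnn a)
      (fun k => mul_le_of_le_one_right (by positivity) ((hμ k).le_one a)) hg
  refine ⟨⟨⟨?_, ?_, fun a b hab => ?_, fun a b => ?_⟩, fun a b hab => ?_⟩, fun k a hk => ?_⟩
  · simp [(hμ _).map_bot]
  · simp only [(hμ _).map_top, mul_one]
    exact tsum_geometric_two' 1
  · refine (hs a).tsum_le_tsum (fun k => ?_) (hs b)
    exact mul_le_mul_of_nonneg_left ((hμ k).mono a b hab) (by positivity)
  · rw [← (hs a).tsum_add (hs b)]
    refine (hs _).tsum_le_tsum (fun k => ?_) ((hs a).add (hs b))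
    rw [← mul_add]
    exact mul_le_mul_of_nonneg_left ((hμ k).sup_le a b) (by positivity)
  · rw [← (hs a).tsum_add (hs b)]
    simp only [(hμ _).sup_eq a b hab, mul_add]
  · exact (hs a).tsum_pos (hnn a) k (mul_pos (by positivity) hk)

theorem IsExhaustiveBase.exists_isFinAddMeasure {B : Type*} [BooleanAlgebra B] [Nontrivial B]
    {V : ℕ → Set B} (hV : IsExhaustiveBase V) :
    ∃ m : B → ℝ, IsFinAddMeasure m ∧ VanishesOnlyAtBot m := by
  -- Starting at `k₀` keeps the complements nonempty, as Kelley's criterion requires; the sets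
  -- decrease, so nothing is lost.
  obtain ⟨k₀, hk₀⟩ : ∃ k, ⊤ ∉ V k := by
    by_contra! h
    exact top_ne_bot (hV.eq_bot ⊤ h)
  have key : ∀ k, ∃ μ : B → ℝ, IsFinAddMeasure μ ∧ ∀ a ∉ V (k + k₀), 0 < μ a := by
    intro k
    obtain ⟨l, hl⟩ := hV.sup_mem (k + k₀)
    obtain ⟨l', hl'⟩ := hV.sup_mem l
    obtain ⟨r, hr⟩ := hV.meets (max l l')
    refine exists_isFinAddMeasure_pos (A := (V (k + k₀))ᶜ) (N := 18 * (r + 1) ^ 2)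
      ⟨⊤, fun h => hk₀ (hV.anti (by omega) h)⟩ (by positivity) fun ι _ _ a ha => ?_
    refine exists_card_le_mul_card_inf_ne_bot (W := V (max l l')) ?_ (hV.bot_mem _) hr a ha
    intro a ha b hb c hc
    exact hl _ (hl' _ (hV.anti (le_max_right _ _) ha) _ (hV.anti (le_max_right _ _) hb)) _
      (hV.anti (le_max_left _ _) hc)
  choose μ hμ hpos using key
  obtain ⟨hm, hm'⟩ := IsFinAddMeasure.tsum_geometric hμ
  refine ⟨_, hm, fun a ha => hV.eq_bot a fun k => ?_⟩
  by_contra hk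
  exact (hm' k a (hpos k a fun h => hk (hV.anti (by omega) h))).ne' ha

theorem theorem5p2 {B : Type*} [BooleanAlgebra B] [Nontrivial B] :
    (∃ m : B → ℝ, IsFinAddMeasure m ∧ VanishesOnlyAtBot m) ↔
      ∃ I : Set (ℕ → B), IsConvergenceIdeal I ∧ IsUniformlyFrechet I ∧ IsConcentrated I := by
  constructor
  · rintro ⟨m, hm, hpos⟩
    exact ⟨_, hm.isConvergenceIdeal hpos, hm.isUniformlyFrechet, hm.isConcentrated⟩
  · rintro ⟨I, hI, hF, hc⟩
    obtain ⟨V, hV⟩ := hI.exists_isExhaustiveBase hF hc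
    exact hV.exists_isFinAddMeasure
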